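/- Let $G$ be a compact, connected (real, finite-dimensional, smooth) Lie group with identity $e$ and Lie algebra $\mathfrak g\cong T_eG$ of left-invariant vector fields, let $X_1,\dots,X_m\in\mathfrak g$, and let $T>0$. Let $(x_r,u^r_1,\dots,u^r_m)$ be a $T$-periodic trajectory of the left-invariant driftless system $x'=\sum_{k=1}^m u_kX_k(x)$; that is, $u^r_1,\dots,u^r_m:\mathbb R\to\mathbb R$ are smooth and $T$-periodic, and $x_r:\mathbb R\to G$ is $T$-periodic and satisfies $x_r'(t)=\sum_{k=1}^m u^r_k(t)X_k(x_r(t))$ for all $t\in\mathbb R$. For $x\in G$ let $\mathrm{Ad}(x):\mathfrak g\to\mathfrak g$ be the differential at $e$ of $y\mapsto xyx^{-1}$, and put $V(x)=\operatorname{tr}\mathrm{Ad}(x)$. For $(t,w)\in\mathbb R\times G$ define $$a_k(t,w)=\mathrm dV\big((\mathrm{Ad}(x_r(t))X_k)(w)\big)\quad(1\le k\le m),\qquad W(t,w)=\sum_{k=1}^m a_k(t,w)\,(\mathrm{Ad}(x_r(t))X_k)(w),$$ where $(\mathrm{Ad}(x_r(t))X_k)(w)\in T_wG$ is the value at $w$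 of the left-invariant vector field $\mathrm{Ad}(x_r(t))X_k$. For $(t_0,w_0)\in\mathbb R\times G$ let $\omega_W(t_0,w_0)$ be the set of all $w\in G$ for which there is an increasing sequence $t_n\to\infty$ with $\mathbf w(t_n)\to w$, where $\mathbf w:\mathbb R\to G$ is the integral curve of the time-dependent vector field $W$ with $\mathbf w(t_0)=w_0$. Then for every $(t_0,w_0)\in\mathbb R\times G$ and every $w\in\omega_W(t_0,w_0)$, $$a_k(t,w)=0\quad\text{for all }t\in\mathbb R\text{ and all }k\in\{1,\dots,m\}.$$ In particular, every $\omega$-limit point $w$ of $W$ is a critical point of $W$, i.e. $W(t,w)=0$ for all $t\in\mathbb R$. -/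

import Mathlib

open Filter Topology
open scoped Manifold ContDiff

noncomputable section

namespace PeriodicTracking

section TimeDependent

variable {E : Type*} [NormedAddCommGroup E] [NormedSpace ℝ E]
  {H : Type*} [TopologicalSpace H] (I : ModelWithCorners ℝ E H)
  {M : Type*} [TopologicalSpace M] [ChartedSpace H M]

/-- `γ : ℝ → M` is a (global) integral curve of the time-dependent vector field `X`:
`γ' t = X (t, γ t)` for every `t`. -/
def IsTimeIntegralCurve (X : ℝ → (x : M) → TangentSpace I x) (γ : ℝ → M) : Prop :=
  ∀ t : ℝ, HasMFDerivAt 𝓘(ℝ, ℝ) I γ t ((1 : ℝ →L[ℝ] ℝ).smulRight (X t (γ t)))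

/-- The `ω`-limit set of `(t₀, x₀)` for the time-dependent vector field `X`: all limits of
`γ (s n)`, where `γ` is the integral curve of `X` with `γ t₀ = x₀` and `s` is an increasing
sequence of times tending to infinity. -/
def omegaLimitSet (X : ℝ → (x : M) → TangentSpace I x) (t₀ : ℝ) (x₀ : M) : Set M :=
  {x | ∃ γ : ℝ → M, IsTimeIntegralCurve I X γ ∧ γ t₀ = x₀ ∧
    ∃ s : ℕ → ℝ, StrictMono s ∧ Tendsto s atTop atTop ∧ Tendsto (fun n => γ (s n)) atTop (𝓝 x)}

/-- The critical points of a time-dependent vector field: the points where it vanishes at all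
times. -/
def criticalPoints (X : ℝ → (x : M) → TangentSpace I x) : Set M :=
  {x | ∀ t : ℝ, X t x = 0}

end TimeDependent

section LieGroup

variable {E : Type*} [NormedAddCommGroup E] [NormedSpace ℝ E]
  {H : Type*} [TopologicalSpace H] (I : ModelWithCorners ℝ E H)
  {G : Type*} [TopologicalSpace G] [ChartedSpace H G] [Group G]

/-- The adjoint map: `Ad x` is the differential at the identity of `y ↦ x * y * x⁻¹`. -/
def Ad (x : G) : GroupLieAlgebra I G →L[ℝ] GroupLieAlgebra I G :=
  mfderiv I I (fun y : G => x * y * x⁻¹) 1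

/-- The Lyapunov-like function `V x = tr (Ad x)`. -/
def lyapunovV (x : G) : ℝ :=
  LinearMap.trace ℝ (GroupLieAlgebra I G) (Ad I x).toLinearMap

/-- `(x, u₁, …, u_m)` is a smooth trajectory of the left-invariant driftless system
`x' = ∑ k, u k • X k (x)`; a left-invariant vector field is given by its value at the identity. -/
structure IsTrajectory {m : ℕ} (X : Fin m → GroupLieAlgebra I G)
    (x : ℝ → G) (u : Fin m → ℝ → ℝ) : Prop where
  contDiff_control : ∀ k, ContDiff ℝ ∞ (u k)
  isTimeIntegralCurve : IsTimeIntegralCurve I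
    (fun t g => ∑ k, u k t • mulInvariantVectorField (X k) g) x

/-- A `T`-periodic trajectory: a trajectory whose curve and controls are all `T`-periodic,
with `T > 0`. -/
structure IsPeriodicTrajectory {m : ℕ} (X : Fin m → GroupLieAlgebra I G) (T : ℝ)
    (x : ℝ → G) (u : Fin m → ℝ → ℝ) : Prop extends IsTrajectory I X x u where
  period_pos : 0 < T
  periodic_curve : Function.Periodic x T
  periodic_control : ∀ k, Function.Periodic (u k) T

/-- The left-invariant vector field `Ad (xr t) (X k)`, evaluated at `w`. -/
def adField {m : ℕ} (X : Fin m → GroupLieAlgebra I G) (xr : ℝ → G) (k : Fin m)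
    (t : ℝ) (w : G) : TangentSpace I w :=
  mulInvariantVectorField (Ad I (xr t) (X k)) w

/-- The feedback functions `a k (t, w) = dV (Ad (xr t) (X k) (w))`. -/
def feedback {m : ℕ} (X : Fin m → GroupLieAlgebra I G) (xr : ℝ → G) (k : Fin m)
    (t : ℝ) (w : G) : ℝ :=
  mfderiv I 𝓘(ℝ, ℝ) (lyapunovV I : G → ℝ) w (adField I X xr k t w)

/-- The auxiliary vector field `W (t, w) = ∑ k, a k (t, w) • Ad (xr t) (X k) (w)`. -/
def auxField {m : ℕ} (X : Fin m → GroupLieAlgebra I G) (xr : ℝ → G)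
    (t : ℝ) (w : G) : TangentSpace I w :=
  ∑ k, feedback I X xr k t w • adField I X xr k t w

end LieGroup

end PeriodicTracking

end

/-! `V` is the trace of `Ad`, so everything can be pushed to the linear space of endomorphisms. With
`A = Ad w(t)`, `B = Ad x_r(t)` and `Z k = A * ad (B (X k))`, the feedback is `tr (Z k)` and `A' = ∑
tr (Z k) • Z k`, hence `(tr A)' = ∑ (tr (Z k))²`. Compactness of the group keeps `A` and `B` in a
compact set, so Barbalat's lemma forces `tr (Z k) → 0`, and then `A' → 0`. The times `s n` can
therefore be moved by less than one period, to times congruent to any prescribed `t`, without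
changing the limit of `A`. Passing to the limit there gives `tr (Z k) = 0` at time `t`. Only `Ad w`
enters the feedback, so the shifted points of the curve need not converge in `G`. -/

namespace PeriodicTracking

/-! ### Asymptotics of gradient-like equations with a periodic parameter. -/

section Analysis

/-- Barbalat's lemma: the derivative of a bounded above differentiable function tends to zero at
infinity if it is nonnegative and uniformly continuous. -/
theorem tendsto_zero_of_hasDerivAt_of_uniformContinuous {h g : ℝ → ℝ}
    (hh : ∀ t, HasDerivAt h (g t) t) (hg : UniformContinuous g) (hg0 : ∀ t, 0 ≤ g t)
    (hb : BddAbove (Set.range h)) : Tendsto g atTop (𝓝 0) := by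
  have hmono : Monotone h :=
    monotone_of_deriv_nonneg (fun t => (hh t).differentiableAt) fun t => (hh t).deriv ▸ hg0 t
  have hlim := tendsto_atTop_ciSup hmono hb
  rw [Metric.tendsto_atTop]
  intro ε hε
  obtain ⟨δ, hδ, hgδ⟩ := Metric.uniformContinuous_iff.1 hg (ε / 2) (half_pos hε)
  have hdiff : Tendsto (fun t => (h (t + δ / 2) - h t) / (δ / 2)) atTop (𝓝 0) := by
    simpa using ((hlim.comp (tendsto_atTop_add_const_right _ (δ / 2) tendsto_id)).sub
      hlim).div_const (δ / 2)
  obtain ⟨N, hN⟩ := Metric.tendsto_atTop.1 hdiff (ε / 2) (half_pos hε)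
  refine ⟨N, fun t ht => ?_⟩
  -- The small difference quotient is a value `g c` with `c` within `δ` of `t`.
  obtain ⟨c, hc, hslope⟩ := exists_hasDerivAt_eq_slope h g (show t < t + δ / 2 by linarith)
    (fun x _ => (hh x).continuousAt.continuousWithinAt) fun x _ => hh x
  have h1 : dist (g t) (g c) < ε / 2 :=
    hgδ (by rw [Real.dist_eq, abs_lt]; constructor <;> linarith [hc.1, hc.2])
  have h2 := hN t ht
  rw [add_sub_cancel_left] at hslope
  rw [← hslope] at h2
  linarith [dist_triangle (g t) (g c) 0]

/-- A continuous periodic function on the real line is uniformly continuous. -/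
theorem uniformContinuous_of_periodic {P : Type*} [UniformSpace P] {f : ℝ → P} {T : ℝ}
    (hT : 0 < T) (hf : Continuous f) (hp : Function.Periodic f T) : UniformContinuous f := by
  have : Fact (0 < T) := ⟨hT⟩
  have hlift : Continuous (hp.lift : AddCircle T → P) := continuous_quot_lift _ hf
  have hmk : UniformContinuous (QuotientAddGroup.mk' (AddSubgroup.zmultiples T)) :=
    uniformContinuous_addMonoidHom_of_continuous (AddCircle.continuous_mk' T)
  exact (CompactSpace.uniformContinuous_of_continuous hlift).comp hmk

/-- Let `A` be a bounded solution of `A' = ∑ k, τ (Z k (A, B)) • Z k (A, B)`, where `τ` is a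
continuous linear functional and `B` is a periodic parameter. Then all the functions
`τ (Z k (p, B))` vanish identically if `p` is an `ω`-limit point of `A`. -/
theorem eq_zero_of_tendsto_of_hasDerivAt_sum_smul {F P ι : Type*} [Fintype ι]
    [NormedAddCommGroup F] [NormedSpace ℝ F] [PseudoMetricSpace P]
    {Z : ι → F × P → F} (hZ : ∀ k, Continuous (Z k)) (τ : F →L[ℝ] ℝ)
    {A : ℝ → F} {B : ℝ → P} {T : ℝ} (hT : 0 < T) (hB : Continuous B)
    (hBT : Function.Periodic B T) {K : Set F} {K' : Set P} (hK : IsCompact K)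
    (hK' : IsCompact K') (hAK : ∀ t, A t ∈ K) (hBK : ∀ t, B t ∈ K')
    (hA : ∀ t, HasDerivAt A (∑ k, τ (Z k (A t, B t)) • Z k (A t, B t)) t)
    {s : ℕ → ℝ} (hs : Tendsto s atTop atTop) {p : F}
    (hp : Tendsto (fun n => A (s n)) atTop (𝓝 p)) (t : ℝ) (k : ι) :
    τ (Z k (p, B t)) = 0 := by
  have hKK : IsCompact (K ×ˢ K') := hK.prod hK'
  have hmem : ∀ t, (A t, B t) ∈ K ×ˢ K' := fun t => ⟨hAK t, hBK t⟩
  have hZb : ∀ k, ∃ C, ∀ t, ‖Z k (A t, B t)‖ ≤ C := fun k => by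
    obtain ⟨C, hC⟩ := hKK.exists_bound_of_continuousOn (hZ k).continuousOn
    exact ⟨C, fun t => hC _ (hmem t)⟩
  choose C hC using hZb
  obtain ⟨C', hC'⟩ := hKK.exists_bound_of_continuousOn
    (show Continuous fun q => ∑ k, τ (Z k q) • Z k q by fun_prop).continuousOn
  -- `A'` is a continuous function on a compact set, hence bounded, so `A` is Lipschitz.
  have hAu : UniformContinuous A := by
    refine (LipschitzWith.of_dist_le_mul (K := C'.toNNReal) fun x y => ?_).uniformContinuous
    rw [dist_eq_norm, dist_eq_norm]
    refine Convex.norm_image_sub_le_of_norm_hasDerivWithin_le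
      (fun x _ => (hA x).hasDerivWithinAt)
      (fun x _ => (hC' _ (hmem x)).trans (Real.le_coe_toNNReal _)) convex_univ
      (Set.mem_univ _) (Set.mem_univ _)
  have hABu : UniformContinuous fun t => (A t, B t) :=
    hAu.prodMk (uniformContinuous_of_periodic hT hB hBT)
  have hgu : UniformContinuous fun t => ∑ k, τ (Z k (A t, B t)) ^ 2 := by
    have hu := hKK.uniformContinuousOn_of_continuous
      (show Continuous fun q => ∑ k, τ (Z k q) ^ 2 by fun_prop).continuousOn
    have := (uniformContinuousOn_iff_restrict.1 hu).comp
      (hABu.subtype_mk hmem)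
    exact this
  have hder : ∀ t, HasDerivAt (fun t => τ (A t)) (∑ k, τ (Z k (A t, B t)) ^ 2) t := fun t => by
    have := τ.hasFDerivAt.comp_hasDerivAt t (hA t)
    simpa [Function.comp_def, sq] using this
  have hsum : Tendsto (fun t => ∑ k, τ (Z k (A t, B t)) ^ 2) atTop (𝓝 0) := by
    refine tendsto_zero_of_hasDerivAt_of_uniformContinuous hder hgu
      (fun t => Finset.sum_nonneg fun k _ => sq_nonneg _) ?_
    refine (hK.image τ.continuous).bddAbove.mono ?_
    rintro _ ⟨t, rfl⟩
    exact ⟨_, hAK t, rfl⟩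
  have ha : ∀ k, Tendsto (fun t => τ (Z k (A t, B t))) atTop (𝓝 0) := fun k => by
    have h2 : Tendsto (fun t => τ (Z k (A t, B t)) ^ 2) atTop (𝓝 0) :=
      squeeze_zero (fun t => sq_nonneg _) (fun t => Finset.single_le_sum
        (f := fun k => τ (Z k (A t, B t)) ^ 2) (fun k _ => sq_nonneg _) (Finset.mem_univ k)) hsum
    have h3 := (Real.continuous_sqrt.tendsto 0).comp h2
    rw [Real.sqrt_zero] at h3
    refine (tendsto_zero_iff_abs_tendsto_zero _).2 (h3.congr fun t => ?_)
    simp [Real.sqrt_sq_eq_abs]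
  have hA' : Tendsto (fun t => ∑ k, τ (Z k (A t, B t)) • Z k (A t, B t)) atTop (𝓝 0) := by
    rw [← Finset.sum_const_zero (s := Finset.univ (α := ι))]
    refine tendsto_finsetSum _ fun k _ => ?_
    exact (ha k).zero_smul_isBoundedUnder_le
      (isBoundedUnder_of ⟨C k, fun t => by simpa using hC k t⟩)
  -- `r n` lies in `[s n, s n + T)` and satisfies `B (r n) = B t`.
  choose r hr hBr using fun n => hBT.exists_mem_Ico hT t (s n)
  have hrs : Tendsto r atTop atTop := tendsto_atTop_mono (fun n => (hr n).1) hs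
  have hAr : Tendsto (fun n => A (r n) - A (s n)) atTop (𝓝 0) := by
    rw [Metric.tendsto_atTop]
    intro ε hε
    -- Speed at most `ε / (2 * T)` over a time at most `T` moves `A` by at most `ε / 2`.
    obtain ⟨N, hN⟩ := Metric.tendsto_atTop.1 hA' (ε / (2 * T)) (by positivity)
    obtain ⟨n₀, hn₀⟩ := eventually_atTop.1 (hs.eventually_ge_atTop N)
    refine ⟨n₀, fun n hn => ?_⟩
    have hle := Convex.norm_image_sub_le_of_norm_hasDerivWithin_le (s := Set.Ici (s n))
      (fun x _ => (hA x).hasDerivWithinAt)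
      (fun x hx => (show _ ≤ ε / (2 * T) by
        simpa using (hN x ((hn₀ n hn).trans hx)).le)) (convex_Ici _)
      (Set.mem_Ici.2 le_rfl) (Set.mem_Ici.2 (hr n).1)
    rw [dist_zero_right]
    refine hle.trans_lt ?_
    have hlt : ‖r n - s n‖ ≤ T := by
      rw [Real.norm_eq_abs, abs_le]
      constructor <;> linarith [(hr n).1, (hr n).2]
    calc ε / (2 * T) * ‖r n - s n‖ ≤ ε / (2 * T) * T := by gcongr
      _ = ε / 2 := by field_simp
      _ < ε := half_lt_self hε
  have hArp : Tendsto (fun n => A (r n)) atTop (𝓝 p) := by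
    simpa using hAr.add hp
  have hlim : Tendsto (fun n => τ (Z k (A (r n), B t))) atTop (𝓝 (τ (Z k (p, B t)))) :=
    ((τ.continuous.comp (hZ k)).tendsto (p, B t)).comp (hArp.prodMk_nhds tendsto_const_nhds)
  refine tendsto_nhds_unique hlim (((ha k).comp hrs).congr fun n => ?_)
  simp only [Function.comp_apply, hBr n]

end Analysis

/-! ### The adjoint representation and its derivative. -/

section AdjointMap

variable {E : Type*} [NormedAddCommGroup E] [NormedSpace ℝ E]
  {H : Type*} [TopologicalSpace H] (I : ModelWithCorners ℝ E H)
  {G : Type*} [TopologicalSpace G] [ChartedSpace H G] [Group G]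

/-- The adjoint map, with values in the endomorphisms of the model space. -/
noncomputable def adModel (x : G) : E →L[ℝ] E := Ad I x

variable (G) in
/-- The differential at the identity of the adjoint map. -/
noncomputable def adDeriv : E →L[ℝ] E →L[ℝ] E :=
  mfderiv I 𝓘(ℝ, E →L[ℝ] E) (adModel I : G → E →L[ℝ] E) 1

/-- The trace, as a continuous linear functional on the endomorphisms of `E`. -/
noncomputable def traceCLM (E : Type*) [NormedAddCommGroup E] [NormedSpace ℝ E]
    [FiniteDimensional ℝ E] : (E →L[ℝ] E) →L[ℝ] ℝ :=
  (LinearMap.trace ℝ E ∘ₗ ContinuousLinearMap.coeLM ℝ).toContinuousLinearMap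

theorem lyapunovV_eq_traceCLM [FiniteDimensional ℝ E] :
    (lyapunovV I : G → ℝ) = traceCLM E ∘ adModel I :=
  rfl

variable [LieGroup I ∞ G]

theorem mdifferentiableAt_conj (x y : G) :
    MDifferentiableAt I I (fun z : G => x * z * x⁻¹) y := by
  have : ContMDiff I I ∞ (fun z : G => x * z * x⁻¹) :=
    (contMDiff_const.mul contMDiff_id).mul contMDiff_const
  exact this.contMDiffAt.mdifferentiableAt (by simp)

theorem adModel_mul (x y : G) : adModel I (x * y) = adModel I x * adModel I y := by
  have hcomp : (fun z : G => x * y * z * (x * y)⁻¹) =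
      (fun z : G => x * z * x⁻¹) ∘ fun z : G => y * z * y⁻¹ := by
    ext z
    simp [mul_assoc]
  let c : G → E →L[ℝ] E := fun z => mfderiv I I (fun w : G => x * w * x⁻¹) z
  have h : adModel I (x * y) = c (y * 1 * y⁻¹) * adModel I y := by
    unfold adModel Ad
    rw [hcomp]
    exact mfderiv_comp (1 : G) (mdifferentiableAt_conj I x _) (mdifferentiableAt_conj I y 1)
  rw [h, mul_one, mul_inv_cancel]
  rfl

/-- Differentiating a jointly smooth map in one variable leaves a smooth dependence on the other.
All base points and values are `1`, so the tangent coordinate changes are trivial. -/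
theorem mdifferentiableAt_adModel_one :
    MDifferentiableAt I 𝓘(ℝ, E →L[ℝ] E) (adModel I : G → E →L[ℝ] E) 1 := by
  have hf : ContMDiffAt (I.prod I) I ∞
      (Function.uncurry fun x y : G => x * y * x⁻¹) ((1 : G), (1 : G)) :=
    ((contMDiff_fst.mul contMDiff_snd).mul contMDiff_fst.inv).contMDiffAt
  have h : ContMDiffAt I 𝓘(ℝ, E →L[ℝ] E) 1 (inTangentCoordinates I I (fun _ : G => (1 : G))
      (fun x : G => x * 1 * x⁻¹) (adModel I) 1) 1 :=
    ContMDiffAt.mfderiv (m := 1) (fun x y : G => x * y * x⁻¹) (fun _ : G => (1 : G)) hf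
      contMDiffAt_const (by norm_cast)
  have hone : (fun x : G => x * 1 * x⁻¹) = fun _ => 1 := by
    ext x
    simp
  have heq : inTangentCoordinates I I (fun _ : G => (1 : G)) (fun _ : G => (1 : G))
      (adModel I) 1 = adModel I := by
    funext x
    rw [inTangentCoordinates_eq (fun _ : G => (1 : G)) (fun _ : G => (1 : G)) _
      (mem_chart_source H (1 : G)) (mem_chart_source H (1 : G))]
    ext v
    have hself : ∀ v : E, (tangentBundleCore I G).coordChange (achart H (1 : G))
        (achart H (1 : G)) (1 : G) v = v :=
      fun v => (tangentBundleCore I G).coordChange_self _ _ (mem_achart_source H (1 : G)) v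
    simp only [ContinuousLinearMap.comp_apply, hself]
  rw [hone, heq] at h
  exact h.mdifferentiableAt one_ne_zero

theorem mdifferentiableAt_leftMul (x y : G) : MDifferentiableAt I I (fun z : G => x * z) y :=
  (contMDiff_mul_left (I := I) (n := ∞)).contMDiffAt.mdifferentiableAt (by simp)

/-- Multiplicativity carries differentiability from `1` to every point by translation. -/
theorem mdifferentiable_adModel :
    MDifferentiable I 𝓘(ℝ, E →L[ℝ] E) (adModel I : G → E →L[ℝ] E) := by
  intro x
  have hx : (adModel I : G → E →L[ℝ] E) =
      (ContinuousLinearMap.mul ℝ (E →L[ℝ] E) (adModel I x)) ∘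
        (adModel I ∘ fun z : G => x⁻¹ * z) := by
    ext1 z
    simp [← adModel_mul]
  have hone : MDifferentiableAt I 𝓘(ℝ, E →L[ℝ] E) (adModel I : G → E →L[ℝ] E) (x⁻¹ * x) := by
    rw [inv_mul_cancel]
    exact mdifferentiableAt_adModel_one I
  rw [hx]
  exact (ContinuousLinearMap.differentiableAt _).mdifferentiableAt.comp x
    (hone.comp x (mdifferentiableAt_leftMul I x⁻¹ x))

/-- Differentiate `Ad (x * z) = Ad x * Ad z` in `z` at `1`. -/
theorem mfderiv_adModel_mulInvariantVectorField (x : G) (v : GroupLieAlgebra I G) :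
    (mfderiv I 𝓘(ℝ, E →L[ℝ] E) (adModel I : G → E →L[ℝ] E) x (mulInvariantVectorField v x) :
      E →L[ℝ] E) = adModel I x * adDeriv I G v := by
  -- The chain rule yields the derivative at `x * 1`; this moves it to `x` across the dependent
  -- tangent spaces.
  have hx : ∀ z : G, z = x → ∀ u : E,
      (mfderiv I 𝓘(ℝ, E →L[ℝ] E) (adModel I : G → E →L[ℝ] E) z u : E →L[ℝ] E) =
        mfderiv I 𝓘(ℝ, E →L[ℝ] E) (adModel I : G → E →L[ℝ] E) x u := by
    rintro _ rfl u
    rfl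
  have h1 : HasMFDerivAt I 𝓘(ℝ, E →L[ℝ] E) (adModel I ∘ fun z : G => x * z) 1 _ :=
    (mdifferentiable_adModel I (x * 1)).hasMFDerivAt.comp (1 : G)
      (mdifferentiableAt_leftMul I x 1).hasMFDerivAt
  have h2 : HasMFDerivAt I 𝓘(ℝ, E →L[ℝ] E)
      (ContinuousLinearMap.mul ℝ (E →L[ℝ] E) (adModel I x) ∘ (adModel I : G → E →L[ℝ] E)) 1 _ :=
    (ContinuousLinearMap.hasFDerivAt _).hasMFDerivAt.comp (1 : G)
      (mdifferentiableAt_adModel_one I).hasMFDerivAt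
  have hfun : (adModel I ∘ fun z : G => x * z) =
      ContinuousLinearMap.mul ℝ (E →L[ℝ] E) (adModel I x) ∘ (adModel I : G → E →L[ℝ] E) := by
    ext1 z
    simp [adModel_mul]
  rw [hfun] at h1
  have h3 := hasMFDerivAt_unique h1 h2
  have h4 := congrArg (fun L => L v) h3
  exact (hx _ (mul_one x) _).symm.trans h4

theorem continuous_adModel : Continuous (adModel I : G → E →L[ℝ] E) :=
  (mdifferentiable_adModel I).continuous

variable [FiniteDimensional ℝ E]

theorem mfderiv_lyapunovV_mulInvariantVectorField (x : G) (v : GroupLieAlgebra I G) :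
    mfderiv I 𝓘(ℝ, ℝ) (lyapunovV I : G → ℝ) x (mulInvariantVectorField v x) =
      traceCLM E (adModel I x * adDeriv I G v) := by
  have h : HasMFDerivAt I 𝓘(ℝ, ℝ) (traceCLM E ∘ (adModel I : G → E →L[ℝ] E)) x _ :=
    (traceCLM E).hasFDerivAt.hasMFDerivAt.comp x (mdifferentiable_adModel I x).hasMFDerivAt
  rw [lyapunovV_eq_traceCLM, h.mfderiv, ← mfderiv_adModel_mulInvariantVectorField]
  rfl

theorem feedback_eq_traceCLM {m : ℕ} (X : Fin m → GroupLieAlgebra I G) (xr : ℝ → G)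
    (k : Fin m) (t : ℝ) (w : G) :
    feedback I X xr k t w =
      traceCLM E (adModel I w * adDeriv I G (adModel I (xr t) (X k))) :=
  mfderiv_lyapunovV_mulInvariantVectorField I w _

/-- `Ad` turns the flow of `W` into a closed equation for `Ad (γ t)`, of the form treated by
`eq_zero_of_tendsto_of_hasDerivAt_sum_smul`. -/
theorem hasDerivAt_adModel_comp {m : ℕ} {X : Fin m → GroupLieAlgebra I G} {xr : ℝ → G}
    {γ : ℝ → G} (hγ : IsTimeIntegralCurve I (auxField I X xr) γ) (t : ℝ) :
    HasDerivAt (fun t => adModel I (γ t))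
      (∑ k, traceCLM E (adModel I (γ t) * adDeriv I G (adModel I (xr t) (X k))) •
        (adModel I (γ t) * adDeriv I G (adModel I (xr t) (X k)))) t := by
  let L : ℝ →L[ℝ] E →L[ℝ] E :=
    (mfderiv I 𝓘(ℝ, E →L[ℝ] E) (adModel I : G → E →L[ℝ] E) (γ t)).comp
      ((1 : ℝ →L[ℝ] ℝ).smulRight (auxField I X xr t (γ t)))
  have h : HasMFDerivAt 𝓘(ℝ, ℝ) 𝓘(ℝ, E →L[ℝ] E) (adModel I ∘ γ) t L :=
    (mdifferentiable_adModel I (γ t)).hasMFDerivAt.comp t (hγ t)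
  have h' : HasFDerivAt (fun t => adModel I (γ t)) L t := hasMFDerivAt_iff_hasFDerivAt.1 h
  refine h'.hasDerivAt.congr_deriv ?_
  have hW : (mfderiv I 𝓘(ℝ, E →L[ℝ] E) (adModel I : G → E →L[ℝ] E) (γ t)
      (auxField I X xr t (γ t)) : E →L[ℝ] E) = ∑ k, feedback I X xr k t (γ t) •
        (mfderiv I 𝓘(ℝ, E →L[ℝ] E) (adModel I : G → E →L[ℝ] E) (γ t)
          (adField I X xr k t (γ t)) : E →L[ℝ] E) := by
    unfold auxField
    refine (map_sum _ _ _).trans (Finset.sum_congr rfl fun k _ => ?_)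
    exact map_smul _ _ _
  calc _ = (mfderiv I 𝓘(ℝ, E →L[ℝ] E) (adModel I : G → E →L[ℝ] E) (γ t)
        ((1 : ℝ) • auxField I X xr t (γ t)) : E →L[ℝ] E) := rfl
    _ = _ := by
      rw [one_smul, hW]
      refine Finset.sum_congr rfl fun k _ => ?_
      rw [feedback_eq_traceCLM]
      exact congrArg _ (mfderiv_adModel_mulInvariantVectorField I (γ t) _)

end AdjointMap

end PeriodicTracking

theorem mainTheorem2
    {E : Type*} [NormedAddCommGroup E] [NormedSpace ℝ E] [FiniteDimensional ℝ E]
    {H : Type*} [TopologicalSpace H] (I : ModelWithCorners ℝ E H) [I.Boundaryless]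
    {G : Type*} [TopologicalSpace G] [ChartedSpace H G] [Group G] [LieGroup I ∞ G]
    [T2Space G] [CompactSpace G] [ConnectedSpace G]
    {m : ℕ} (X : Fin m → GroupLieAlgebra I G)
    {T : ℝ} {xr : ℝ → G} {ur : Fin m → ℝ → ℝ}
    (hr : PeriodicTracking.IsPeriodicTrajectory I X T xr ur)
    (t₀ : ℝ) (w₀ w : G)
    (hw : w ∈ PeriodicTracking.omegaLimitSet I (PeriodicTracking.auxField I X xr) t₀ w₀) :
    (∀ (t : ℝ) (k : Fin m), PeriodicTracking.feedback I X xr k t w = 0) ∧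
      w ∈ PeriodicTracking.criticalPoints I (PeriodicTracking.auxField I X xr) := by
  open PeriodicTracking in
  obtain ⟨γ, hγ, -, s, -, hs, hsw⟩ := hw
  have hxr : Continuous xr :=
    continuous_iff_continuousAt.2 fun t => (hr.isTimeIntegralCurve t).continuousAt
  have hAd : Continuous (adModel I : G → E →L[ℝ] E) := continuous_adModel I
  have hK : IsCompact (Set.range (adModel I : G → E →L[ℝ] E)) := isCompact_range hAd
  have hzero : ∀ (t : ℝ) (k : Fin m), feedback I X xr k t w = 0 := fun t k => by
    rw [feedback_eq_traceCLM]
    -- Viewing the `X k` in the model space makes `Z` a family of maps between normed spaces.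
    let Y : Fin m → E := X
    exact eq_zero_of_tendsto_of_hasDerivAt_sum_smul
      (Z := fun (k : Fin m) (q : (E →L[ℝ] E) × (E →L[ℝ] E)) => q.1 * adDeriv I G (q.2 (Y k)))
      (fun k => by fun_prop) (traceCLM E) (A := fun t => adModel I (γ t))
      (B := fun t => adModel I (xr t)) hr.period_pos (hAd.comp hxr)
      (hr.periodic_curve.comp _) hK hK (fun _ => ⟨_, rfl⟩) (fun _ => ⟨_, rfl⟩)
      (hasDerivAt_adModel_comp I hγ) hs ((hAd.tendsto w).comp hsw) t k
  refine ⟨hzero, fun t => ?_⟩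
  simp only [auxField, hzero, zero_smul, Finset.sum_const_zero]
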